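/- Let $n\ge 4$. The triangular graph $T_n$ is the line graph of the complete graph $K_n$: its vertices are the $2$-element subsets of $\{1,\dots,n\}$, two of them being adjacent when they share exactly one element. Let $X$ be the clique complex of $T_n$, let $X_i$ be the set of its $i$-dimensional faces (cliques with $i+1$ vertices), and fix any total order on the vertices of $T_n$. Let $\delta_1$ be the real matrix with rows indexed by $X_2$ and columns indexed by $X_1$ whose entry at $(H,F)$ is $(-1)^j$ if $H=\{x_0<x_1<x_2\}$, $F\subset H$ and $H\setminus F=\{x_j\}$, and is $0$ otherwise. Then the spectrum of the up-Laplacian $L_1^{\uparrow}(T_n)=\delta_1^{T}\delta_1$ is $$\begin{pmatrix} 0 & 2 & n-1 & n & n+2\\ \binom n2-1 & \binom{n-1}2 & \frac{n(n-2)(n-4)}3 & \binom{n-1}2 & \binom{n-1}3\end{pmatrix},$$ where the first row lists the eigenvalues and the second row their multiplicities: these multiplicities are the dimensions of the corresponding eigenspaces, and $$\det(xI-L_1^{\uparrow}(T_n)) = x^{\binom n2-1}(x-2)^{\binom{n-1}2}(x-n+1)^{n(n-2)(n-4)/3}(x-n)^{\binom{n-1}2}(x-n-2)^{\binom{n-1}3}.$$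 In particular, for $n\ge5$ the distinct eigenvalues are exactly the five numbers $0,2,n-1,n,n+2$. For $n=4$ the multiplicity listed for $n-1=3$ is $0$, so the distinct eigenvalues are exactly $0,2,4,6$. -/

import Mathlib

/-! Coboundary matrices and up-Laplacians of finite abstract simplicial complexes,
clique complexes of graphs, and triangular graphs. -/

namespace CliqueSpectra

/-- The clique complex of a graph: its faces are the nonempty finite cliques. -/
def cliqueComplex {V : Type*} (G : SimpleGraph V) : AbstractSimplicialComplex V where
  faces := {s | s.Nonempty ∧ G.IsClique (s : Set V)}
  isRelLowerSet_faces := fun _ hs =>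
    ⟨hs.1, fun _ hts ht => ⟨ht, hs.2.subset (Finset.coe_subset.mpr hts)⟩⟩
  singleton_mem := fun v => ⟨Finset.singleton_nonempty v, by simp⟩

/-- The type `X_i` of `i`-dimensional faces: the faces with `i + 1` vertices. -/
abbrev Face {V : Type*} (X : AbstractSimplicialComplex V) (i : ℕ) : Type _ :=
  {s : Finset V // s ∈ X ∧ s.card = i + 1}

noncomputable instance {V : Type*} [Finite V] (X : AbstractSimplicialComplex V) (i : ℕ) :
    Fintype (Face X i) :=
  Fintype.ofFinite _

/-- The sign `[F : K]`: if `F = {x_0 < x_1 < ⋯ < x_i}`, it is `(-1) ^ j` when `K ⊆ F` and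
`F \ K = {x_j}`, and `0` when there is no such `j`. The index `j` of a vertex `x` of `F` is the
number of vertices of `F` that are smaller than `x`; at most one `x` contributes to the sum. -/
def incidence {V : Type*} [LinearOrder V] (F K : Finset V) : ℝ :=
  ∑ x ∈ F, if K ⊆ F ∧ F \ K = {x} then (-1) ^ (F.filter (fun y => y < x)).card else 0

/-- The coboundary matrix `δ_i`, with rows indexed by `X_{i+1}` and columns by `X_i`. -/
def coboundary {V : Type*} [LinearOrder V] (X : AbstractSimplicialComplex V) (i : ℕ) :
    Matrix (Face X (i + 1)) (Face X i) ℝ :=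
  Matrix.of fun H F => incidence H.1 F.1

/-- The up-Laplacian `δ_iᵀ δ_i` of a finite simplicial complex. -/
noncomputable def upLaplacian {V : Type*} [Finite V] [LinearOrder V]
    (X : AbstractSimplicialComplex V) (i : ℕ) : Matrix (Face X i) (Face X i) ℝ :=
  (coboundary X i).transpose * coboundary X i

/-- The vertices of the triangular graph: the edges of the complete graph on `n` vertices,
that is, the 2-element subsets of an `n`-element set. -/
abbrev TriangularVertex (n : ℕ) : Type :=
  (⊤ : SimpleGraph (Fin n)).edgeSet

/-- The triangular graph, the line graph of the complete graph on `n` vertices. -/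
abbrev triangularGraph (n : ℕ) : SimpleGraph (TriangularVertex n) :=
  (⊤ : SimpleGraph (Fin n)).lineGraph

end CliqueSpectra

namespace CliqueSpectra

/-! ### Cochains of a clique complex as alternating functions on adjacent pairs. -/

section Graph

variable {V : Type*} [LinearOrder V] {G : SimpleGraph V}

/-! A 1-face of the complex is a pair {a,b}, {a,c}: a centre a and two further points. So a
1-cochain is a function φ(a,b,c) of distinct triples, alternating in b and c, and the matrix has
size n·C(n-1,2). The common neighbours of {a,b} and {a,c} are {b,c} and the {a,d}, hence (Lφ)(a,b,c)
= φ(a,b,c) + φ(b,c,a) + φ(c,a,b) + Σ_{d ≠ a,b,c} (φ(a,b,c) + φ(a,c,d) + φ(a,d,b)), with no trace of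
the chosen vertex order (`tripleExt_upLaplacian_mulVec`).

Eigenvectors are then written down explicitly. Let p_1, …, p_n be vectors spanning ℝ^(n-1) with sum
0. Because of this relation, every sum over d reduces to the few terms with d in {a,b,c}. For n+2:
w(p_a,p_b,p_c), with w a 3-form. For n: η(b,c) = w(p_b,p_c), with w a 2-form. For 2: a combination
of η(b,c) and η(a,b) + η(c,a). For 0: coboundaries of vertex functions modulo constants. For n-1:
one 2-form on ℝ^(n-2) for each centre, subject to the C(n,3) conditions that cyclic sums vanish.

Each family injects into its eigenspace (`finrank_le_finrank_eigenspace`), which only gives lower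
bounds for the dimensions. These bounds add up to n·C(n-1,2) (`choose_identities`), so all of them
are equalities and the characteristic polynomial is determined (`charpoly_eq_prod_of_le_finrank`).
-/

theorem incidence_eq_sum_erase (F K : Finset V) :
    incidence F K =
      ∑ x ∈ F, if K = F.erase x then (-1 : ℝ) ^ (F.filter (fun y => y < x)).card else 0 := by
  refine Finset.sum_congr rfl fun x hx => if_congr ?_ rfl rfl
  constructor
  · rintro ⟨h1, h2⟩
    rw [← Finset.sdiff_singleton_eq_erase, ← h2, Finset.sdiff_sdiff_eq_self h1]
  · rintro rfl
    refine ⟨Finset.erase_subset _ _, ?_⟩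
    ext y
    simp only [Finset.mem_sdiff, Finset.mem_erase, Finset.mem_singleton]
    grind

theorem pair_mem_cliqueComplex {u v : V} (h : G.Adj u v) :
    ({u, v} : Finset V) ∈ cliqueComplex G ∧ ({u, v} : Finset V).card = 1 + 1 := by
  refine ⟨⟨by simp, ?_⟩, Finset.card_pair h.ne⟩
  simp only [Finset.coe_pair, SimpleGraph.isClique_pair]
  exact fun _ => h

theorem triple_mem_cliqueComplex {u v w : V} (h : G.Adj u v) (h1 : G.Adj u w) (h2 : G.Adj v w) :
    ({u, v, w} : Finset V) ∈ cliqueComplex G ∧ ({u, v, w} : Finset V).card = 2 + 1 := by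
  have := SimpleGraph.is3Clique_triple_iff.2 ⟨h, h1, h2⟩
  exact ⟨⟨by simp, this.1⟩, this.2⟩

/-- The edge of a graph joining two adjacent vertices, as a face of the clique complex. -/
def edgeFace {u v : V} (h : G.Adj u v) : Face (cliqueComplex G) 1 :=
  ⟨{u, v}, pair_mem_cliqueComplex h⟩

theorem edgeFace_symm {u v : V} (h : G.Adj u v) : edgeFace h.symm = edgeFace h :=
  Subtype.ext (Finset.pair_comm v u)

/-- Every `1`-face comes from a unique increasing pair of adjacent vertices. -/
theorem exists_edgeFace (F : Face (cliqueComplex G) 1) :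
    ∃ (u v : V) (h : G.Adj u v), u < v ∧ F = edgeFace h := by
  obtain ⟨s, hs, hc⟩ := F
  obtain ⟨u, v, huv, rfl⟩ := Finset.card_eq_two.1 hc
  have h : G.Adj u v := hs.2 (by simp) (by simp) huv
  rcases huv.lt_or_gt with hlt | hlt
  · exact ⟨u, v, h, hlt, rfl⟩
  · exact ⟨v, u, h.symm, hlt, (edgeFace_symm h).symm⟩

theorem edgeFace_inj {u v u' v' : V} {h : G.Adj u v} {h' : G.Adj u' v'} (huv : u < v)
    (huv' : u' < v') (he : edgeFace h = edgeFace h') : u = u' ∧ v = v' := by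
  have he' : ({u, v} : Finset V) = {u', v'} := congrArg Subtype.val he
  have h1 : u ∈ ({u', v'} : Finset V) := he' ▸ by simp
  have h2 : v ∈ ({u', v'} : Finset V) := he' ▸ by simp
  simp only [Finset.mem_insert, Finset.mem_singleton] at h1 h2
  grind

open Classical in
/-- The alternating function on ordered pairs of vertices given by a `1`-cochain. -/
noncomputable def altExt (g : Face (cliqueComplex G) 1 → ℝ) (u v : V) : ℝ :=
  if h : G.Adj u v then (if u < v then g (edgeFace h) else -g (edgeFace h)) else 0

theorem altExt_of_lt (g : Face (cliqueComplex G) 1 → ℝ) {u v : V} (h : G.Adj u v) (hlt : u < v) :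
    altExt g u v = g (edgeFace h) := by
  simp [altExt, h, hlt]

theorem altExt_swap (g : Face (cliqueComplex G) 1 → ℝ) (u v : V) :
    altExt g v u = -altExt g u v := by
  by_cases h : G.Adj u v
  · rcases h.ne.lt_or_gt with hlt | hlt
    · simp [altExt, h, h.symm, hlt, hlt.not_gt, edgeFace_symm h]
    · simp [altExt, h, h.symm, hlt, hlt.not_gt, edgeFace_symm h]
  · simp [altExt, G.adj_comm v u, h]

theorem altExt_add_smul (g g' : Face (cliqueComplex G) 1 → ℝ) (c : ℝ) (u v : V) :
    altExt (g + c • g') u v = altExt g u v + c * altExt g' u v := by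
  unfold altExt
  split_ifs <;> simp
  ring

theorem eq_of_altExt_eq {g g' : Face (cliqueComplex G) 1 → ℝ}
    (hg : ∀ u v, G.Adj u v → altExt g u v = altExt g' u v) : g = g' := by
  funext F
  obtain ⟨u, v, h, hlt, rfl⟩ := exists_edgeFace F
  rw [← altExt_of_lt g h hlt, hg u v h, altExt_of_lt g' h hlt]

theorem exists_altExt_eq (f : V → V → ℝ) (hf : ∀ u v, G.Adj u v → f v u = -f u v) :
    ∃ g : Face (cliqueComplex G) 1 → ℝ, ∀ u v, G.Adj u v → altExt g u v = f u v := by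
  choose a b h hlt he using exists_edgeFace (G := G)
  refine ⟨fun F => f (a F) (b F), ?_⟩
  have key : ∀ u v, G.Adj u v → u < v → altExt (fun F => f (a F) (b F)) u v = f u v := by
    intro u v huv huv'
    rw [altExt_of_lt _ huv huv']
    obtain ⟨h1, h2⟩ := edgeFace_inj huv' (hlt (edgeFace huv)) (he (edgeFace huv))
    rw [← h1, ← h2]
  intro u v huv
  rcases huv.ne.lt_or_gt with hl | hl
  · exact key u v huv hl
  · rw [altExt_swap, key v u huv.symm hl, hf u v huv, neg_neg]

theorem incidence_triple {x y z : V} (hxy : x < y) (hyz : y < z) (K : Finset V) :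
    incidence {x, y, z} K = (if K = {y, z} then 1 else 0) - (if K = {x, z} then 1 else 0)
      + (if K = {x, y} then 1 else 0) := by
  have hxz := hxy.trans hyz
  rw [incidence_eq_sum_erase, Finset.sum_insert (by simp [hxy.ne, hxz.ne]),
    Finset.sum_insert (by simp [hyz.ne]), Finset.sum_singleton]
  have e1 : ({x, y, z} : Finset V).erase x = {y, z} := by grind
  have e2 : ({x, y, z} : Finset V).erase y = {x, z} := by grind
  have e3 : ({x, y, z} : Finset V).erase z = {x, y} := by grind
  have f1 : ({x, y, z} : Finset V).filter (fun t => t < x) = ∅ := by grind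
  have f2 : ({x, y, z} : Finset V).filter (fun t => t < y) = {x} := by grind
  have f3 : ({x, y, z} : Finset V).filter (fun t => t < z) = {x, y} := by grind
  rw [e1, e2, e3, f1, f2, f3, Finset.card_pair hxy.ne]
  simp only [Finset.card_empty, Finset.card_singleton]
  split_ifs <;> norm_num

theorem pairs_ne {x y z : V} (hxy : x < y) (hyz : y < z) :
    ({y, z} : Finset V) ≠ {x, z} ∧ ({y, z} : Finset V) ≠ {x, y} ∧ ({x, z} : Finset V) ≠ {x, y} := by
  have hxz := hxy.trans hyz
  refine ⟨fun h => ?_, fun h => ?_, fun h => ?_⟩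
  · have : x ∈ ({y, z} : Finset V) := h ▸ by simp
    grind
  · have : x ∈ ({y, z} : Finset V) := h ▸ by simp
    grind
  · have : z ∈ ({x, y} : Finset V) := h ▸ by simp
    grind

variable [Finite V]

theorem coboundary_mulVec_triple (g : Face (cliqueComplex G) 1 → ℝ) {x y z : V}
    (hxy : x < y) (hyz : y < z) (h1 : G.Adj x y) (h2 : G.Adj x z) (h3 : G.Adj y z) :
    (coboundary (cliqueComplex G) 1).mulVec g ⟨{x, y, z}, triple_mem_cliqueComplex h1 h2 h3⟩
      = altExt g y z - altExt g x z + altExt g x y := by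
  have key : ∀ {u v : V} (h : G.Adj u v), u < v →
      ∑ F : Face (cliqueComplex G) 1, (if F.1 = {u, v} then (1 : ℝ) else 0) * g F
        = altExt g u v := by
    intro u v h hlt
    rw [altExt_of_lt g h hlt, Finset.sum_eq_single (edgeFace h)]
    · simp [edgeFace]
    · intro F _ hF
      rw [if_neg fun h' : F.1 = {u, v} => hF (Subtype.ext h'), zero_mul]
    · simp
  simp only [Matrix.mulVec, dotProduct, coboundary, Matrix.of_apply,
    incidence_triple hxy hyz, add_mul, sub_mul, Finset.sum_add_distrib, Finset.sum_sub_distrib]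
  rw [key h1 hxy, key h2 (hxy.trans hyz), key h3 hyz]

/-- The sign of the pair in the triangle occurs twice and cancels, so the value is the oriented
boundary sum u → v → w → u wherever w lies in the order. -/
theorem incidence_mul_coboundary_mulVec (g : Face (cliqueComplex G) 1 → ℝ) {u v w : V}
    (huv : u < v) (h : G.Adj u v) (h1 : G.Adj u w) (h2 : G.Adj v w) :
    incidence ({u, v, w} : Finset V) {u, v} * (coboundary (cliqueComplex G) 1).mulVec g
        ⟨{u, v, w}, triple_mem_cliqueComplex h h1 h2⟩
      = altExt g u v + altExt g v w + altExt g w u := by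
  rcases lt_trichotomy w u with hw | rfl | hw
  · have e : ({u, v, w} : Finset V) = {w, u, v} := by grind
    simp only [e]
    obtain ⟨n1, n2, n3⟩ := pairs_ne hw huv
    rw [coboundary_mulVec_triple g hw huv h1.symm h2.symm h, incidence_triple hw huv,
      if_pos rfl, if_neg n1, if_neg n2, altExt_swap g v w]
    ring
  · exact absurd h1 (G.loopless.irrefl _)
  rcases lt_trichotomy w v with hw' | rfl | hw'
  · have e : ({u, v, w} : Finset V) = {u, w, v} := by grind
    simp only [e]
    obtain ⟨n1, n2, n3⟩ := pairs_ne hw hw'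
    rw [coboundary_mulVec_triple g hw hw' h1 h h2.symm, incidence_triple hw hw',
      if_pos rfl, if_neg n1.symm, if_neg n3, altExt_swap g v w, altExt_swap g w u]
    ring
  · exact absurd h2 (G.loopless.irrefl _)
  · obtain ⟨n1, n2, n3⟩ := pairs_ne huv hw'
    rw [coboundary_mulVec_triple g huv hw' h h1 h2, incidence_triple huv hw',
      if_pos rfl, if_neg n2.symm, if_neg n3.symm, altExt_swap g w u]
    ring

open Classical in
/-- The up-Laplacian in terms of alternating functions on ordered pairs of vertices. -/
theorem altExt_upLaplacian_mulVec [Fintype V] (g : Face (cliqueComplex G) 1 → ℝ) {u v : V}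
    (h : G.Adj u v) :
    altExt ((upLaplacian (cliqueComplex G) 1).mulVec g) u v
      = ∑ w with G.Adj u w ∧ G.Adj v w, (altExt g u v + altExt g v w + altExt g w u) := by
  have key : ∀ {u v : V} (h : G.Adj u v), u < v →
      altExt ((upLaplacian (cliqueComplex G) 1).mulVec g) u v
      = ∑ w with G.Adj u w ∧ G.Adj v w, (altExt g u v + altExt g v w + altExt g w u) := by
    intro u v h huv
    rw [altExt_of_lt _ h huv, upLaplacian, ← Matrix.mulVec_mulVec]
    change ∑ H : Face (cliqueComplex G) 2, incidence H.1 {u, v} * _ = _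
    symm
    -- Triangles not containing {u, v} have incidence zero; the others correspond to the common
    -- neighbours w through w ↦ {u, v, w}.
    refine Finset.sum_bij_ne_zero
      (fun w hw _ => ⟨{u, v, w}, triple_mem_cliqueComplex h (Finset.mem_filter.1 hw).2.1
        (Finset.mem_filter.1 hw).2.2⟩) (fun _ _ _ => Finset.mem_univ _) ?_ ?_ ?_
    · intro w hw _ w' hw' _ he
      have he' : ({u, v, w} : Finset V) = {u, v, w'} := congrArg Subtype.val he
      have hm : w ∈ ({u, v, w'} : Finset V) := he' ▸ by simp
      have n1 := (Finset.mem_filter.1 hw).2.1.ne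
      have n2 := (Finset.mem_filter.1 hw).2.2.ne
      grind
    · rintro ⟨s, hs, hc⟩ _ hne
      have hne' := left_ne_zero_of_mul hne
      obtain ⟨x, hx, hx'⟩ := Finset.exists_ne_zero_of_sum_ne_zero hne'
      obtain ⟨hsub, hd⟩ := (ite_ne_right_iff.1 hx').1
      change {u, v} ⊆ s at hsub
      change s \ {u, v} = {x} at hd
      have hsx : s = {u, v, x} := by
        have := Finset.sdiff_union_of_subset hsub
        rw [hd] at this
        rw [← this]
        grind
      subst hsx
      have hxn : x ∉ ({u, v} : Finset V) := by
        have : x ∈ ({u, v, x} : Finset V) \ {u, v} := by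
          rw [hd]
          exact Finset.mem_singleton_self x
        exact (Finset.mem_sdiff.1 this).2
      simp only [Finset.mem_insert, Finset.mem_singleton, not_or] at hxn
      have a1 : G.Adj u x := hs.2 (by simp) (by simp) (Ne.symm hxn.1)
      have a2 : G.Adj v x := hs.2 (by simp) (by simp) (Ne.symm hxn.2)
      refine ⟨x, by simp [a1, a2], ?_, rfl⟩
      rwa [← incidence_mul_coboundary_mulVec g huv h a1 a2]
    · intro w hw _
      exact (incidence_mul_coboundary_mulVec g huv h (Finset.mem_filter.1 hw).2.1
        (Finset.mem_filter.1 hw).2.2).symm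
  rcases h.ne.lt_or_gt with hl | hl
  · exact key h hl
  · rw [altExt_swap, key h.symm hl, ← Finset.sum_neg_distrib]
    refine Finset.sum_congr (by ext; simp [and_comm]) fun w _ => ?_
    rw [altExt_swap g u v, altExt_swap g w u, altExt_swap g v w]
    ring

end Graph

/-! ### The triangular graph: cochains as functions of a centre and two points. -/

section Triangular

variable {n : ℕ}

/-- The vertex `{a, b}` of the triangular graph. -/
def edge {a b : Fin n} (h : a ≠ b) : TriangularVertex n :=
  ⟨s(a, b), by simpa using h⟩

theorem edge_comm {a b : Fin n} (h : a ≠ b) : edge h.symm = edge h :=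
  Subtype.ext Sym2.eq_swap

theorem exists_edge_eq (e : TriangularVertex n) : ∃ (a b : Fin n) (h : a ≠ b), e = edge h := by
  obtain ⟨⟨a, b⟩, h⟩ := e
  exact ⟨a, b, by simpa using h, rfl⟩

theorem edge_adj {a b c : Fin n} (hab : a ≠ b) (hac : a ≠ c) (hbc : b ≠ c) :
    (triangularGraph n).Adj (edge hab) (edge hac) := by
  rw [SimpleGraph.lineGraph_adj_iff_exists]
  refine ⟨fun h => hbc ?_, a, by simp [edge], by simp [edge]⟩
  exact Sym2.congr_right.1 (congrArg Subtype.val h)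

theorem edge_eq_of_mem {e : TriangularVertex n} {a : Fin n} (h : a ∈ e.1) :
    ∃ (b : Fin n) (hab : a ≠ b), e = edge hab := by
  obtain ⟨e, he⟩ := e
  obtain ⟨b, rfl⟩ := Sym2.mem_iff_exists.1 h
  exact ⟨b, by simpa using he, rfl⟩

theorem exists_edge_of_adj {e e' : TriangularVertex n} (h : (triangularGraph n).Adj e e') :
    ∃ (a b c : Fin n) (hab : a ≠ b) (hac : a ≠ c), b ≠ c ∧ e = edge hab ∧ e' = edge hac := by
  obtain ⟨hne, a, h1, h2⟩ := SimpleGraph.lineGraph_adj_iff_exists.1 h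
  obtain ⟨b, hab, rfl⟩ := edge_eq_of_mem h1
  obtain ⟨c, hac, rfl⟩ := edge_eq_of_mem h2
  refine ⟨a, b, c, hab, hac, ?_, rfl, rfl⟩
  rintro rfl
  exact hne rfl

/-- Two distinct edges of the complete graph share at most one point, so the centre is determined;
this makes triples faithful coordinates for ordered adjacent pairs. -/
theorem edge_pair_inj {a b c a' b' c' : Fin n} {hab : a ≠ b} {hac : a ≠ c} {hab' : a' ≠ b'}
    {hac' : a' ≠ c'} (hbc : b ≠ c) (h1 : edge hab = edge hab') (h2 : edge hac = edge hac') :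
    a = a' ∧ b = b' ∧ c = c' := by
  have h1' : s(a, b) = s(a', b') := congrArg Subtype.val h1
  have h2' : s(a, c) = s(a', c') := congrArg Subtype.val h2
  rw [Sym2.eq_iff] at h1' h2'
  grind

/-- An edge meeting both and avoiding a must contain b and c. The two cases are the two kinds of
triangles of the graph, triangles and stars in the complete graph. -/
theorem common_neighbor {a b c : Fin n} (hab : a ≠ b) (hac : a ≠ c) (hbc : b ≠ c)
    {w : TriangularVertex n} (h1 : (triangularGraph n).Adj (edge hab) w)
    (h2 : (triangularGraph n).Adj (edge hac) w) :
    w = edge hbc ∨ ∃ (d : Fin n) (had : a ≠ d), d ≠ b ∧ d ≠ c ∧ w = edge had := by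
  obtain ⟨n1, x, hx, hx'⟩ := SimpleGraph.lineGraph_adj_iff_exists.1 h1
  obtain ⟨n2, y, hy, hy'⟩ := SimpleGraph.lineGraph_adj_iff_exists.1 h2
  by_cases ha : a ∈ w.1
  · obtain ⟨d, had, rfl⟩ := edge_eq_of_mem ha
    refine Or.inr ⟨d, had, ?_, ?_, rfl⟩
    · rintro rfl
      exact n1 rfl
    · rintro rfl
      exact n2 rfl
  · left
    rw [edge, Sym2.mem_iff] at hx hy
    have hb : b ∈ w.1 := by
      rcases hx with rfl | rfl
      · exact absurd hx' ha
      · exact hx'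
    have hc : c ∈ w.1 := by
      rcases hy with rfl | rfl
      · exact absurd hy' ha
      · exact hy'
    exact Subtype.ext ((Sym2.mem_and_mem_iff hbc).1 ⟨hb, hc⟩)

theorem edge_adj_opposite {a b c : Fin n} (hab : a ≠ b) (hac : a ≠ c) (hbc : b ≠ c) :
    (triangularGraph n).Adj (edge hab) (edge hbc) := by
  rw [← edge_comm]
  exact edge_adj _ _ hac

variable [LinearOrder (TriangularVertex n)]

/-- A `1`-cochain of the clique complex of the triangular graph as a function of triples
`(a, b, c)`, to be read as the edge from `{a, b}` to `{a, c}`. -/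
noncomputable def tripleExt (g : Face (cliqueComplex (triangularGraph n)) 1 → ℝ)
    (a b c : Fin n) : ℝ :=
  if h : a ≠ b ∧ a ≠ c then altExt g (edge h.1) (edge h.2) else 0

theorem tripleExt_of_ne (g : Face (cliqueComplex (triangularGraph n)) 1 → ℝ) {a b c : Fin n}
    (hab : a ≠ b) (hac : a ≠ c) : tripleExt g a b c = altExt g (edge hab) (edge hac) :=
  dif_pos ⟨hab, hac⟩

/-- The linear map sending a `1`-cochain to the corresponding function of triples. -/
noncomputable def tripleMap : (Face (cliqueComplex (triangularGraph n)) 1 → ℝ) →ₗ[ℝ]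
    (Fin n → Fin n → Fin n → ℝ) where
  toFun := tripleExt
  map_add' g g' := by
    funext a b c
    by_cases h : a ≠ b ∧ a ≠ c
    · have := altExt_add_smul g g' 1 (edge h.1) (edge h.2)
      simpa [tripleExt, h] using this
    · simp [tripleExt, dif_neg h]
  map_smul' r g := by
    funext a b c
    by_cases h : a ≠ b ∧ a ≠ c
    · have := altExt_add_smul 0 g r (edge h.1) (edge h.2)
      have h0 := altExt_add_smul 0 0 1 (edge h.1) (edge h.2) (G := triangularGraph n)
      simp only [zero_add, smul_zero, one_mul, left_eq_add] at this h0
      simp [tripleExt, h, this, h0]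
    · simp [tripleExt, dif_neg h]

theorem eq_of_tripleExt_eq {g g' : Face (cliqueComplex (triangularGraph n)) 1 → ℝ}
    (h : ∀ a b c, a ≠ b → a ≠ c → b ≠ c → tripleExt g a b c = tripleExt g' a b c) : g = g' := by
  refine eq_of_altExt_eq fun u v huv => ?_
  obtain ⟨a, b, c, hab, hac, hbc, rfl, rfl⟩ := exists_edge_of_adj huv
  rw [← tripleExt_of_ne, ← tripleExt_of_ne, h a b c hab hac hbc]

theorem exists_tripleExt_eq (φ : Fin n → Fin n → Fin n → ℝ)
    (hφ : ∀ a b c, a ≠ b → a ≠ c → b ≠ c → φ a c b = -φ a b c) :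
    ∃ g : Face (cliqueComplex (triangularGraph n)) 1 → ℝ,
      ∀ a b c, a ≠ b → a ≠ c → b ≠ c → tripleExt g a b c = φ a b c := by
  classical
  choose A B C hAB hAC hBC h1 h2 using
    fun (e e' : TriangularVertex n) (h : (triangularGraph n).Adj e e') => exists_edge_of_adj h
  let f : TriangularVertex n → TriangularVertex n → ℝ := fun e e' =>
    if h : (triangularGraph n).Adj e e' then φ (A e e' h) (B e e' h) (C e e' h) else 0
  have hf : ∀ a b c (hab : a ≠ b) (hac : a ≠ c), b ≠ c → f (edge hab) (edge hac) = φ a b c := by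
    intro a b c hab hac hbc
    have h := edge_adj hab hac hbc
    obtain ⟨e1, e2, e3⟩ := edge_pair_inj hbc (h1 _ _ h) (h2 _ _ h)
    simp only [f, dif_pos h, ← e1, ← e2, ← e3]
  obtain ⟨g, hg⟩ := exists_altExt_eq (G := triangularGraph n) f (by
    intro u v huv
    obtain ⟨a, b, c, hab, hac, hbc, rfl, rfl⟩ := exists_edge_of_adj huv
    rw [hf _ _ _ _ _ hbc, hf _ _ _ _ _ hbc.symm, hφ a b c hab hac hbc])
  refine ⟨g, fun a b c hab hac hbc => ?_⟩
  rw [tripleExt_of_ne g hab hac, hg _ _ (edge_adj hab hac hbc), hf _ _ _ _ _ hbc]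

/-- The up-Laplacian of the triangular graph in terms of functions of triples. -/
theorem tripleExt_upLaplacian_mulVec (g : Face (cliqueComplex (triangularGraph n)) 1 → ℝ)
    {a b c : Fin n} (hab : a ≠ b) (hac : a ≠ c) (hbc : b ≠ c) :
    tripleExt ((upLaplacian (cliqueComplex (triangularGraph n)) 1).mulVec g) a b c
      = tripleExt g a b c + tripleExt g b c a + tripleExt g c a b
        + ∑ d with d ≠ a ∧ d ≠ b ∧ d ≠ c,
          (tripleExt g a b c + tripleExt g a c d + tripleExt g a d b) := by
  classical
  rw [tripleExt_of_ne _ hab hac, altExt_upLaplacian_mulVec g (edge_adj hab hac hbc),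
    ← Finset.add_sum_erase _ _ (a := edge hbc)]
  · congr 1
    · rw [tripleExt_of_ne g hab hac, tripleExt_of_ne g hbc hab.symm,
        tripleExt_of_ne g hac.symm hbc.symm, edge_comm hab, edge_comm hac, edge_comm hbc]
      ring
    · symm
      refine Finset.sum_bij (fun d hd => edge (Finset.mem_filter.1 hd).2.1.symm) ?_ ?_ ?_ ?_
      · intro d hd
        obtain ⟨-, hda, hdb, hdc⟩ := Finset.mem_filter.1 hd
        simp only [Finset.mem_erase, Finset.mem_filter, Finset.mem_univ, true_and]
        refine ⟨fun h => ?_, edge_adj hab hda.symm hdb.symm, edge_adj hac hda.symm hdc.symm⟩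
        have : s(a, d) = s(b, c) := congrArg Subtype.val h
        rw [Sym2.eq_iff] at this
        grind
      · intro d hd d' hd' h
        exact Sym2.congr_right.1 (congrArg Subtype.val h)
      · intro w hw
        simp only [Finset.mem_erase, Finset.mem_filter, Finset.mem_univ, true_and] at hw
        rcases common_neighbor hab hac hbc hw.2.1 hw.2.2 with h | ⟨d, had, hdb, hdc, rfl⟩
        · exact absurd h hw.1
        · exact ⟨d, by simp [had.symm, hdb, hdc], rfl⟩
      · intro d hd
        obtain ⟨-, hda, hdb, hdc⟩ := Finset.mem_filter.1 hd
        rw [tripleExt_of_ne g hab hac, tripleExt_of_ne g hac hda.symm,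
          tripleExt_of_ne g hda.symm hab]
  · simp only [Finset.mem_filter, Finset.mem_univ, true_and]
    refine ⟨edge_adj_opposite hab hac hbc, ?_⟩
    rw [← edge_comm hbc]
    exact edge_adj_opposite hac hab hbc.symm

/-- A linear family of functions of triples on which the up-Laplacian acts as the scalar `μ`
bounds the dimension of the eigenspace of `μ` from below. -/
theorem finrank_le_finrank_eigenspace {W : Type*} [AddCommGroup W] [Module ℝ W]
    [DecidableEq (Face (cliqueComplex (triangularGraph n)) 1)] (μ : ℝ)
    (T : W →ₗ[ℝ] (Fin n → Fin n → Fin n → ℝ))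
    (hT : ∀ w a b c, a ≠ b → a ≠ c → b ≠ c → T w a c b = -T w a b c)
    (hL : ∀ w a b c, a ≠ b → a ≠ c → b ≠ c →
      T w a b c + T w b c a + T w c a b
        + ∑ d with d ≠ a ∧ d ≠ b ∧ d ≠ c, (T w a b c + T w a c d + T w a d b) = μ * T w a b c)
    (hz : ∀ w, (∀ a b c, a ≠ b → a ≠ c → b ≠ c → T w a b c = 0) → w = 0) :
    Module.finrank ℝ W ≤ Module.finrank ℝ
      (Module.End.eigenspace (upLaplacian (cliqueComplex (triangularGraph n)) 1).toLin' μ) := by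
  -- Values of T w at triples with repeated entries are arbitrary, so they are discarded before
  -- comparing with cochains.
  let R : (Fin n → Fin n → Fin n → ℝ) →ₗ[ℝ]
      ({t : Fin n × Fin n × Fin n // t.1 ≠ t.2.1 ∧ t.1 ≠ t.2.2 ∧ t.2.1 ≠ t.2.2} → ℝ) :=
    { toFun := fun φ t => φ t.1.1 t.1.2.1 t.1.2.2
      map_add' := fun _ _ => rfl
      map_smul' := fun _ _ => rfl }
  have hR : ∀ φ ψ, R φ = R ψ ↔ ∀ a b c, a ≠ b → a ≠ c → b ≠ c → φ a b c = ψ a b c :=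
    fun φ ψ => ⟨fun h a b c hab hac hbc => congrFun h ⟨(a, b, c), hab, hac, hbc⟩,
      fun h => funext fun t => h _ _ _ t.2.1 t.2.2.1 t.2.2.2⟩
  -- A left inverse turns the choice of a cochain representing T w into a linear map in w.
  obtain ⟨Q, hQ⟩ := (R ∘ₗ tripleMap).exists_leftInverse_of_injective
    (LinearMap.ker_eq_bot.2 fun g g' h => eq_of_tripleExt_eq ((hR _ _).1 h))
  have hg : ∀ w, ∃ g : Face (cliqueComplex (triangularGraph n)) 1 → ℝ, Q (R (T w)) = g ∧
      ∀ a b c, a ≠ b → a ≠ c → b ≠ c → tripleExt g a b c = T w a b c := by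
    intro w
    obtain ⟨g, hg⟩ := exists_tripleExt_eq (T w) (hT w)
    refine ⟨g, ?_, hg⟩
    rw [← (hR _ _).2 hg]
    exact LinearMap.congr_fun hQ g
  refine LinearMap.finrank_le_finrank_of_injective
    (f := (Q ∘ₗ R ∘ₗ T).codRestrict _ fun w => ?_) ?_
  · obtain ⟨g, hQg, hg⟩ := hg w
    rw [Module.End.mem_eigenspace_iff, LinearMap.comp_apply, LinearMap.comp_apply, hQg,
      Matrix.toLin'_apply]
    refine eq_of_tripleExt_eq fun a b c hab hac hbc => ?_
    have hs := congrFun (congrFun (congrFun (tripleMap.map_smul μ g) a) b) c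
    change _ = μ * tripleExt g a b c at hs
    change _ = tripleMap (μ • g) a b c
    rw [hs, tripleExt_upLaplacian_mulVec g hab hac hbc, hg a b c hab hac hbc,
      hg b c a hbc hab.symm hac.symm, hg c a b hac.symm hbc.symm hab, ← hL w a b c hab hac hbc]
    refine congrArg _ (Finset.sum_congr rfl fun d hd => ?_)
    obtain ⟨-, hda, hdb, hdc⟩ := Finset.mem_filter.1 hd
    rw [hg a c d hac hda.symm hdc.symm, hg a d b hda.symm hab hdb]
  · rw [← LinearMap.ker_eq_bot, LinearMap.ker_eq_bot']
    intro w hw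
    obtain ⟨g, hQg, hg⟩ := hg w
    have h0 : g = 0 := hQg.symm.trans (congrArg Subtype.val hw)
    refine hz w fun a b c hab hac hbc => ?_
    rw [← hg a b c hab hac hbc, h0]
    exact congrFun (congrFun (congrFun tripleMap.map_zero a) b) c

end Triangular

/-! ### Explicit eigenvectors from alternating forms. -/

section Families

theorem finrank_alternatingMap (m k : ℕ) :
    Module.finrank ℝ ((Fin m → ℝ) [⋀^Fin k]→ₗ[ℝ] ℝ) = m.choose k := by
  rw [exteriorPower.alternatingMapLinearEquiv.finrank_eq, Module.finrank_linearMap_self,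
    exteriorPower.finrank_eq, Module.finrank_fin_fun]

instance finite_alternatingMap (m k : ℕ) :
    Module.Finite ℝ ((Fin m → ℝ) [⋀^Fin k]→ₗ[ℝ] ℝ) :=
  Module.Finite.equiv exteriorPower.alternatingMapLinearEquiv.symm

theorem alternatingMap_two_swap {E : Type*} [AddCommGroup E] [Module ℝ E]
    (w : E [⋀^Fin 2]→ₗ[ℝ] ℝ) (x y : E) : w ![y, x] = -w ![x, y] := by
  rw [← w.map_swap ![x, y] (i := 0) (j := 1) (by decide)]
  congr 1
  ext i
  fin_cases i <;> rfl

theorem alternatingMap_two_self {E : Type*} [AddCommGroup E] [Module ℝ E]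
    (w : E [⋀^Fin 2]→ₗ[ℝ] ℝ) (x : E) : w ![x, x] = 0 :=
  w.map_eq_zero_of_eq _ (i := 0) (j := 1) rfl (by decide)

theorem alternatingMap_two_sum {E ι : Type*} [AddCommGroup E] [Module ℝ E] [Fintype ι]
    (w : E [⋀^Fin 2]→ₗ[ℝ] ℝ) (x : E) {q : ι → E} (hq : ∑ i, q i = 0) :
    ∑ i, w ![x, q i] = 0 := by
  have h : ∀ y, w ![x, y] = w (Function.update ![x, 0] 1 y) := fun y => by
    congr 1
    ext i
    fin_cases i <;> rfl
  simp only [h]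
  rw [← AlternatingMap.map_update_sum, hq, AlternatingMap.map_update_zero]

theorem alternatingMap_three_swap {E : Type*} [AddCommGroup E] [Module ℝ E]
    (w : E [⋀^Fin 3]→ₗ[ℝ] ℝ) (x y z : E) : w ![x, z, y] = -w ![x, y, z] := by
  rw [← w.map_swap ![x, y, z] (i := 1) (j := 2) (by decide)]
  congr 1
  ext i
  fin_cases i <;> rfl

theorem alternatingMap_three_rotate {E : Type*} [AddCommGroup E] [Module ℝ E]
    (w : E [⋀^Fin 3]→ₗ[ℝ] ℝ) (x y z : E) : w ![y, z, x] = w ![x, y, z] := by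
  rw [← neg_neg (w ![x, y, z]), ← alternatingMap_three_swap,
    ← w.map_swap ![x, z, y] (i := 0) (j := 2) (by decide)]
  congr 1
  ext i
  fin_cases i <;> rfl

theorem alternatingMap_three_self {E : Type*} [AddCommGroup E] [Module ℝ E]
    (w : E [⋀^Fin 3]→ₗ[ℝ] ℝ) (x y : E) : w ![x, y, x] = 0 :=
  w.map_eq_zero_of_eq _ (i := 0) (j := 2) rfl (by decide)

theorem alternatingMap_three_sum {E ι : Type*} [AddCommGroup E] [Module ℝ E] [Fintype ι]
    (w : E [⋀^Fin 3]→ₗ[ℝ] ℝ) (x y : E) {q : ι → E} (hq : ∑ i, q i = 0) :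
    ∑ i, w ![x, y, q i] = 0 := by
  have h : ∀ z, w ![x, y, z] = w (Function.update ![x, y, 0] 2 z) := fun z => by
    congr 1
    ext i
    fin_cases i <;> rfl
  simp only [h]
  rw [← AlternatingMap.map_update_sum, hq, AlternatingMap.map_update_zero]

/-- The standard basis of `ℝ ^ m`, preceded by minus the sum of its members. -/
def circuit (m : ℕ) : Fin (m + 1) → Fin m → ℝ :=
  Fin.cons (-∑ i, Pi.single i 1) fun i => Pi.single i 1

theorem sum_circuit (m : ℕ) : ∑ a, circuit m a = 0 := by
  simp [circuit, Fin.sum_univ_succ]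

theorem alternatingMap_two_eq_zero {m : ℕ} {w : (Fin m → ℝ) [⋀^Fin 2]→ₗ[ℝ] ℝ}
    (h : ∀ i j, i ≠ j → w ![circuit m i, circuit m j] = 0) : w = 0 := by
  refine Module.Basis.ext_alternating (Pi.basisFun ℝ (Fin m)) fun v hv => ?_
  have := h (v 0).succ (v 1).succ (fun e => by simpa using hv (Fin.succ_injective _ e))
  rw [AlternatingMap.zero_apply, ← this]
  congr 1
  ext i
  fin_cases i <;> simp [circuit]

theorem alternatingMap_three_eq_zero {m : ℕ} {w : (Fin m → ℝ) [⋀^Fin 3]→ₗ[ℝ] ℝ}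
    (h : ∀ i j k, i ≠ j → i ≠ k → j ≠ k → w ![circuit m i, circuit m j, circuit m k] = 0) :
    w = 0 := by
  refine Module.Basis.ext_alternating (Pi.basisFun ℝ (Fin m)) fun v hv => ?_
  have := h (v 0).succ (v 1).succ (v 2).succ (fun e => by simpa using hv (Fin.succ_injective _ e))
    (fun e => by simpa using hv (Fin.succ_injective _ e))
    (fun e => by simpa using hv (Fin.succ_injective _ e))
  rw [AlternatingMap.zero_apply, ← this]
  congr 1
  ext i
  fin_cases i <;> simp [circuit]

/-- Completes the sum over d, so that the zero-sum relation of the circuit applies. -/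
theorem sum_ne_three {n : ℕ} {a b c : Fin n} (hab : a ≠ b) (hac : a ≠ c) (hbc : b ≠ c)
    (f : Fin n → ℝ) :
    ∑ d with d ≠ a ∧ d ≠ b ∧ d ≠ c, f d = ∑ d, f d - f a - f b - f c := by
  have h : (Finset.univ.filter fun d => d ≠ a ∧ d ≠ b ∧ d ≠ c)
      = ((Finset.univ.erase a).erase b).erase c := by
    ext
    simp
    tauto
  rw [h, Finset.sum_erase_eq_sub (by simp [hac.symm, hbc.symm]),
    Finset.sum_erase_eq_sub (by simp [hab.symm]), Finset.sum_erase_eq_sub (by simp)]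

variable {n m : ℕ} [LinearOrder (TriangularVertex n)]
    [DecidableEq (Face (cliqueComplex (triangularGraph n)) 1)]

/-- Alternating `3`-forms give eigenvectors for `n + 2`. -/
theorem choose_three_le_finrank_eigenspace (hm : n = m + 1) :
    m.choose 3 ≤ Module.finrank ℝ (Module.End.eigenspace
      (upLaplacian (cliqueComplex (triangularGraph n)) 1).toLin' ((n : ℝ) + 2)) := by
  subst hm
  rw [← finrank_alternatingMap]
  refine finrank_le_finrank_eigenspace _
    { toFun := fun w a b c => w ![circuit m a, circuit m b, circuit m c]
      map_add' := fun _ _ => rfl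
      map_smul' := fun _ _ => rfl } ?_ ?_ ?_
  · intro w a b c _ _ _
    exact alternatingMap_three_swap w _ _ _
  · intro w a b c hab hac hbc
    simp only [LinearMap.coe_mk, AddHom.coe_mk]
    rw [sum_ne_three hab hac hbc]
    simp only [Finset.sum_add_distrib, alternatingMap_three_sum w _ _ (sum_circuit m)]
    rw [Finset.sum_congr rfl fun d _ => alternatingMap_three_swap w _ (circuit m b) (circuit m d),
      Finset.sum_neg_distrib, alternatingMap_three_sum w _ _ (sum_circuit m)]
    have e1 := alternatingMap_three_rotate w (circuit m a) (circuit m b) (circuit m c)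
    have e2 := alternatingMap_three_rotate w (circuit m b) (circuit m c) (circuit m a)
    have e3 := alternatingMap_three_swap w (circuit m a) (circuit m b) (circuit m c)
    have e4 := alternatingMap_three_self w (circuit m a) (circuit m b)
    have e5 := alternatingMap_three_self w (circuit m a) (circuit m c)
    have e6 := alternatingMap_three_swap w (circuit m a) (circuit m b) (circuit m a)
    have e7 := alternatingMap_three_swap w (circuit m a) (circuit m b) (circuit m b)
    have e8 := alternatingMap_three_swap w (circuit m a) (circuit m c) (circuit m c)
    simp only [e1, e2, e3, e4, e5, e6, Finset.sum_const, Finset.card_univ, Fintype.card_fin,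
      nsmul_eq_mul]
    push_cast
    linarith
  · intro w h
    exact alternatingMap_three_eq_zero h

/-- Alternating `2`-forms give eigenvectors for `n`. -/
theorem choose_two_le_finrank_eigenspace (hm : n = m + 1) (hn : 3 ≤ n) :
    m.choose 2 ≤ Module.finrank ℝ (Module.End.eigenspace
      (upLaplacian (cliqueComplex (triangularGraph n)) 1).toLin' (n : ℝ)) := by
  subst hm
  rw [← finrank_alternatingMap]
  refine finrank_le_finrank_eigenspace _
    { toFun := fun w _ b c => w ![circuit m b, circuit m c]
      map_add' := fun _ _ => rfl
      map_smul' := fun _ _ => rfl } ?_ ?_ ?_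
  · intro w a b c _ _ _
    exact alternatingMap_two_swap w _ _
  · intro w a b c hab hac hbc
    simp only [LinearMap.coe_mk, AddHom.coe_mk]
    rw [sum_ne_three hab hac hbc]
    simp only [Finset.sum_add_distrib, alternatingMap_two_sum w _ (sum_circuit m)]
    rw [Finset.sum_congr rfl fun d _ => alternatingMap_two_swap w (circuit m b) (circuit m d),
      Finset.sum_neg_distrib, alternatingMap_two_sum w _ (sum_circuit m)]
    have e2 := alternatingMap_two_swap w (circuit m a) (circuit m c)
    have e3 := alternatingMap_two_swap w (circuit m b) (circuit m c)
    simp only [e2, e3, alternatingMap_two_self, Finset.sum_const, Finset.card_univ,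
      Fintype.card_fin, nsmul_eq_mul]
    ring
  -- The function does not depend on the centre; n ≥ 3 supplies a centre for each pair.
  · intro w h
    refine alternatingMap_two_eq_zero fun i j hij => ?_
    obtain ⟨a, ha⟩ := Finset.exists_mem_notMem_of_card_lt_card (s := {i, j})
      (t := (Finset.univ : Finset (Fin (m + 1))))
      (by rw [Finset.card_univ, Fintype.card_fin]; exact Finset.card_le_two.trans_lt hn)
    simp only [Finset.mem_insert, Finset.mem_singleton, not_or] at ha
    exact h a i j ha.2.1 ha.2.2 hij

/-- Alternating `2`-forms give eigenvectors for `2`. -/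
theorem choose_two_le_finrank_eigenspace_two (hm : n = m + 1) (hn : 4 ≤ n) :
    m.choose 2 ≤ Module.finrank ℝ (Module.End.eigenspace
      (upLaplacian (cliqueComplex (triangularGraph n)) 1).toLin' 2) := by
  subst hm
  rw [← finrank_alternatingMap]
  let η (w : (Fin m → ℝ) [⋀^Fin 2]→ₗ[ℝ] ℝ) (a b : Fin (m + 1)) : ℝ :=
    w ![circuit m a, circuit m b]
  have hswap : ∀ w a b, η w b a = -η w a b := fun w a b => alternatingMap_two_swap w _ _
  have hself : ∀ w a, η w a a = 0 := fun w a => alternatingMap_two_self w _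
  have hsum : ∀ w a, ∑ b, η w a b = 0 := fun w a => alternatingMap_two_sum w _ (sum_circuit m)
  have hsum' : ∀ w a, ∑ b, η w b a = 0 := fun w a => by
    rw [Finset.sum_congr rfl fun d _ => hswap w a d, Finset.sum_neg_distrib, hsum, neg_zero]
  refine finrank_le_finrank_eigenspace _
    -- Put ψ = η(a,b) + η(c,a). The star terms of ψ cancel, so Lψ = 2ψ + 2η, while Lη = nη; the
    -- eigenvector for 2 in the span is 2η - (n-2)ψ, and n - 2 = m - 1.
    { toFun := fun w a b c => 2 * η w b c - ((m : ℝ) - 1) * (η w a b + η w c a)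
      map_add' := fun w w' => by
        funext a b c
        simp only [η, AlternatingMap.add_apply, Pi.add_apply]
        ring
      map_smul' := fun r w => by
        funext a b c
        simp only [η, AlternatingMap.smul_apply, Pi.smul_apply, smul_eq_mul, RingHom.id_apply]
        ring } ?_ ?_ ?_
  · intro w a b c _ _ _
    simp only [LinearMap.coe_mk, AddHom.coe_mk]
    rw [hswap w b c, hswap w a b, hswap w a c]
    ring
  · intro w a b c hab hac hbc
    simp only [LinearMap.coe_mk, AddHom.coe_mk]
    rw [sum_ne_three hab hac hbc]
    simp only [Finset.sum_add_distrib, Finset.sum_sub_distrib, ← Finset.mul_sum, hsum, hsum',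
      Finset.sum_const, Finset.card_univ, Fintype.card_fin, nsmul_eq_mul, hself]
    rw [hswap w a b, hswap w a c, hswap w b c]
    push_cast
    ring
  · intro w h
    refine alternatingMap_two_eq_zero fun b c hbc => ?_
    obtain ⟨a, ha⟩ := Finset.exists_mem_notMem_of_card_lt_card (s := {b, c})
      (t := (Finset.univ : Finset (Fin (m + 1))))
      (by rw [Finset.card_univ, Fintype.card_fin]; exact Finset.card_le_two.trans_lt (by omega))
    simp only [Finset.mem_insert, Finset.mem_singleton, not_or] at ha
    obtain ⟨-, hab, hac⟩ := ha
    have h1 := h a b c hab hac hbc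
    have h2 := h b c a hbc (Ne.symm hab) (Ne.symm hac)
    have h3 := h c a b (Ne.symm hac) (Ne.symm hbc) hab
    simp only [LinearMap.coe_mk, AddHom.coe_mk] at h1 h2 h3
    have hm : (3 : ℝ) ≤ m := by exact_mod_cast (by omega : 3 ≤ m)
    -- The cyclic sum of the function is (4 - 2m) times this sum, and m ≥ 3 keeps the factor
    -- nonzero.
    have hS : η w a b + η w b c + η w c a = 0 := by
      have : (2 * (m : ℝ) - 4) * (η w a b + η w b c + η w c a) = 0 := by linarith
      exact (mul_eq_zero.1 this).resolve_left (by linarith)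
    have : ((m : ℝ) + 1) * η w b c = 0 := by
      linear_combination h1 + ((m : ℝ) - 1) * hS
    exact (mul_eq_zero.1 this).resolve_left (by linarith)

/-- Coboundaries of functions on the vertices are eigenvectors for `0`. -/
theorem choose_two_sub_one_le_finrank_eigenspace_zero (hn : 3 ≤ n) :
    n.choose 2 - 1 ≤ Module.finrank ℝ (Module.End.eigenspace
      (upLaplacian (cliqueComplex (triangularGraph n)) 1).toLin' 0) := by
  classical
  let v₀ : TriangularVertex n := edge (a := ⟨0, by omega⟩) (b := ⟨1, by omega⟩) (by simp)
  -- Vanishing at one vertex removes the constants, which have zero coboundary.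
  let W := LinearMap.ker (LinearMap.proj (R := ℝ) (φ := fun _ : TriangularVertex n => ℝ) v₀)
  have hW : n.choose 2 - 1 ≤ Module.finrank ℝ W := by
    have h1 := LinearMap.finrank_range_add_finrank_ker
      (LinearMap.proj (R := ℝ) (φ := fun _ : TriangularVertex n => ℝ) v₀)
    have h2 := Submodule.finrank_le (LinearMap.range
      (LinearMap.proj (R := ℝ) (φ := fun _ : TriangularVertex n => ℝ) v₀))
    have h3 : Fintype.card (TriangularVertex n) = n.choose 2 := by
      rw [← SimpleGraph.edgeFinset_card, SimpleGraph.card_edgeFinset_top_eq_card_choose_two,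
        Fintype.card_fin]
    rw [Module.finrank_fintype_fun_eq_card, h3] at h1
    rw [Module.finrank_self] at h2
    change n.choose 2 - 1 ≤ Module.finrank ℝ (LinearMap.ker _)
    omega
  refine hW.trans ?_
  let h (f : TriangularVertex n → ℝ) (a b : Fin n) : ℝ := if hab : a ≠ b then f (edge hab) else 0
  have hc : ∀ f a b, h f b a = h f a b := by
    intro f a b
    by_cases hab : a = b
    · rw [hab]
    · simp only [h, dif_pos hab, dif_pos (Ne.symm hab)]
      rw [edge_comm]
  refine finrank_le_finrank_eigenspace _
    { toFun := fun w a b c => h w a c - h w a b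
      map_add' := fun w w' => by
        funext a b c
        simp only [h, Submodule.coe_add, Pi.add_apply]
        split_ifs <;> ring
      map_smul' := fun r w => by
        funext a b c
        simp only [h, Submodule.coe_smul, Pi.smul_apply, smul_eq_mul, RingHom.id_apply]
        split_ifs <;> ring } ?_ ?_ ?_
  · intro w a b c _ _ _
    simp
  · intro w a b c _ _ _
    simp only [LinearMap.coe_mk, AddHom.coe_mk]
    rw [Finset.sum_eq_zero fun d _ => by ring, hc _ a b, hc _ a c, hc _ b c]
    ring
  · intro w hw
    simp only [LinearMap.coe_mk, AddHom.coe_mk] at hw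
    -- Zero coboundary means equal values at adjacent vertices; every vertex is then joined to `v₀`
    -- by a path, through a vertex containing 0.
    have step : ∀ a b c (hab : a ≠ b) (hac : a ≠ c), w.1 (edge hab) = w.1 (edge hac) := by
      intro a b c hab hac
      by_cases hbc : b = c
      · subst hbc
        rfl
      · have := hw a b c hab hac hbc
        simp only [h, dif_pos hab, dif_pos hac] at this
        linarith
    have h0 : w.1 v₀ = 0 := w.2
    refine Subtype.ext (funext fun e => ?_)
    obtain ⟨a, b, hab, rfl⟩ := exists_edge_eq e
    change _ = (0 : ℝ)
    rw [← h0]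
    by_cases ha : a = ⟨0, by omega⟩
    · subst ha
      exact step _ _ _ _ _
    · rw [step a b _ hab ha, ← edge_comm]
      exact step _ _ _ _ _

/-- Families of alternating `2`-forms, one for each centre, with vanishing cyclic sums give
eigenvectors for `n - 1`. -/
theorem le_finrank_eigenspace_sub_one (hm : n = m + 2) :
    n * m.choose 2 ≤ Module.finrank ℝ (Module.End.eigenspace
      (upLaplacian (cliqueComplex (triangularGraph n)) 1).toLin' ((n : ℝ) - 1))
      + n.choose 3 := by
  subst hm
  -- For centre a, the other n - 1 points carry a circuit in ℝ^(n-2); the value 0 at a itself makes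
  -- terms with d = a vanish.
  let q (a : Fin (m + 2)) : Fin (m + 2) → Fin m → ℝ :=
    a.insertNth (α := fun _ => Fin m → ℝ) 0 (circuit m)
  have hq0 : ∀ a, q a a = 0 := fun a => by simp [q]
  have hqs : ∀ a, ∑ b, q a b = 0 := fun a => by
    rw [Fin.sum_univ_succAbove _ a]
    simp [q, sum_circuit]
  let φ (w : Fin (m + 2) → (Fin m → ℝ) [⋀^Fin 2]→ₗ[ℝ] ℝ) (a b c : Fin (m + 2)) : ℝ := w a ![q a b, q a c]
  have hswap : ∀ w a b c, φ w a c b = -φ w a b c := fun w a b c => alternatingMap_two_swap _ _ _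
  have hself : ∀ w a b, φ w a b b = 0 := fun w a b => alternatingMap_two_self _ _
  have hsum : ∀ w a b, ∑ c, φ w a b c = 0 := fun w a b => alternatingMap_two_sum _ _ (hqs a)
  have hsum' : ∀ w a b, ∑ c, φ w a c b = 0 := fun w a b => by
    rw [Finset.sum_congr rfl fun d _ => hswap w a b d, Finset.sum_neg_distrib, hsum, neg_zero]
  have hzero : ∀ w a b, φ w a b a = 0 := fun w a b => by
    simp only [φ, hq0]
    exact (w a).map_coord_zero 1 rfl
  let I := {t : Fin (m + 2) × Fin (m + 2) × Fin (m + 2) // t.1 < t.2.1 ∧ t.2.1 < t.2.2}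
  have hI : Fintype.card I ≤ (m + 2).choose 3 := by
    have := Finset.card_le_card_of_injOn (s := (Finset.univ : Finset I))
      (t := Finset.powersetCard 3 (Finset.univ : Finset (Fin (m + 2))))
      (fun t => {t.1.1, t.1.2.1, t.1.2.2}) ?_ ?_
    · simpa using this
    · rintro ⟨⟨a, b, c⟩, hab, hbc⟩ _
      change a < b at hab
      change b < c at hbc
      exact Finset.mem_powersetCard.2 ⟨Finset.subset_univ _, Finset.card_eq_three.2
        ⟨a, b, c, hab.ne, (hab.trans hbc).ne, hbc.ne, rfl⟩⟩
    · rintro ⟨⟨a, b, c⟩, hab, hbc⟩ _ ⟨⟨a', b', c'⟩, hab', hbc'⟩ _ h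
      change ({a, b, c} : Finset (Fin (m + 2))) = {a', b', c'} at h
      change a < b at hab
      change b < c at hbc
      change a' < b' at hab'
      change b' < c' at hbc'
      have h1 : a ∈ ({a', b', c'} : Finset (Fin (m + 2))) := h ▸ by simp
      have h2 : b ∈ ({a', b', c'} : Finset (Fin (m + 2))) := h ▸ by simp
      have h3 : c ∈ ({a', b', c'} : Finset (Fin (m + 2))) := h ▸ by simp
      simp only [Finset.mem_insert, Finset.mem_singleton] at h1 h2 h3
      obtain ⟨rfl, rfl, rfl⟩ : a = a' ∧ b = b' ∧ c = c' := by grind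
      rfl
  let C : (Fin (m + 2) → (Fin m → ℝ) [⋀^Fin 2]→ₗ[ℝ] ℝ) →ₗ[ℝ] (I → ℝ) :=
    { toFun := fun w t => φ w t.1.1 t.1.2.1 t.1.2.2 + φ w t.1.2.1 t.1.2.2 t.1.1
        + φ w t.1.2.2 t.1.1 t.1.2.1
      map_add' := fun w w' => by
        funext t
        simp only [φ, AlternatingMap.add_apply, Pi.add_apply]
        ring
      map_smul' := fun r w => by
        funext t
        simp only [φ, AlternatingMap.smul_apply, Pi.smul_apply, smul_eq_mul, RingHom.id_apply]
        ring }
  -- The cyclic sum only changes sign under permutations of a, b, c, so one condition per 3-subset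
  -- suffices.
  have hC : ∀ w, C w = 0 → ∀ a b c, a ≠ b → a ≠ c → b ≠ c →
      φ w a b c + φ w b c a + φ w c a b = 0 := by
    intro w hw
    have key : ∀ a b c, a < b → b < c → φ w a b c + φ w b c a + φ w c a b = 0 :=
      fun a b c hab hbc => congrFun hw ⟨(a, b, c), hab, hbc⟩
    intro a b c hab hac hbc
    have s1 := hswap w a b c
    have s2 := hswap w b c a
    have s3 := hswap w c a b
    rcases hab.lt_or_gt with h1 | h1 <;> rcases hac.lt_or_gt with h2 | h2 <;>
      rcases hbc.lt_or_gt with h3 | h3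
    · exact key a b c h1 h3
    · linarith [key a c b h2 h3]
    · exact absurd (h1.trans h3) h2.not_gt
    · linarith [key c a b h2 h1]
    · linarith [key b a c h1 h2]
    · exact absurd (h1.trans h2) h3.not_gt
    · linarith [key b c a h3 h2]
    · linarith [key c b a h3 h1]
  have hdim : (m + 2) * m.choose 2 ≤ Module.finrank ℝ (LinearMap.ker C) + (m + 2).choose 3 := by
    have h1 := LinearMap.finrank_range_add_finrank_ker C
    have h2 := Submodule.finrank_le (LinearMap.range C)
    rw [Module.finrank_fintype_fun_eq_card] at h2
    have h3 : Module.finrank ℝ (Fin (m + 2) → (Fin m → ℝ) [⋀^Fin 2]→ₗ[ℝ] ℝ) = (m + 2) * m.choose 2 := by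
      rw [Module.finrank_pi_fintype, Finset.sum_const, Finset.card_univ, Fintype.card_fin,
        finrank_alternatingMap, smul_eq_mul]
    omega
  refine hdim.trans (Nat.add_le_add_right ?_ _)
  let T : (Fin (m + 2) → (Fin m → ℝ) [⋀^Fin 2]→ₗ[ℝ] ℝ) →ₗ[ℝ]
      (Fin (m + 2) → Fin (m + 2) → Fin (m + 2) → ℝ) :=
    { toFun := φ
      map_add' := fun _ _ => rfl
      map_smul' := fun _ _ => rfl }
  have hT : ∀ w : LinearMap.ker C, (T ∘ₗ (LinearMap.ker C).subtype) w = φ w := fun _ => rfl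
  refine finrank_le_finrank_eigenspace (W := LinearMap.ker C) _ (T ∘ₗ (LinearMap.ker C).subtype) ?_ ?_ ?_
  · intro w a b c _ _ _
    exact hswap _ _ _ _
  · intro w a b c hab hac hbc
    simp only [hT]
    rw [sum_ne_three hab hac hbc, hC w w.2 a b c hab hac hbc]
    simp only [Finset.sum_add_distrib, hsum, hsum', hself, hzero, hswap _ a b c, hswap _ a b a,
      Finset.sum_const, Finset.card_univ, Fintype.card_fin, nsmul_eq_mul]
    push_cast
    ring
  · intro w hw
    refine Subtype.ext (funext fun a => ?_)
    refine alternatingMap_two_eq_zero fun i j hij => ?_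
    have := hw a (a.succAbove i) (a.succAbove j) (Fin.succAbove_ne a i).symm
      (Fin.succAbove_ne a j).symm (fun h => hij (Fin.succAbove_right_injective h))
    simpa [hT, T, φ, q] using this

end Families

/-! ### From lower bounds on eigenspaces to the full spectrum. -/

section Spectrum

open Polynomial in
/-- If lower bounds for the dimensions of eigenspaces add up to at least the size of the matrix,
then they are the exact dimensions and determine the characteristic polynomial. -/
theorem charpoly_eq_prod_of_le_finrank {ι κ : Type*} [Fintype ι] [DecidableEq ι] [Fintype κ]
    (M : Matrix ι ι ℝ) {μ : κ → ℝ} (hμ : Function.Injective μ) {d : κ → ℕ}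
    (hd : ∀ i, d i ≤ Module.finrank ℝ (Module.End.eigenspace M.toLin' (μ i)))
    (hcard : Fintype.card ι ≤ ∑ i, d i) :
    M.charpoly = ∏ i, (X - C (μ i)) ^ d i ∧
      ∀ i, Module.finrank ℝ (Module.End.eigenspace M.toLin' (μ i)) = d i := by
  have hdvd : ∀ e : κ → ℕ,
      (∀ i, e i ≤ Module.finrank ℝ (Module.End.eigenspace M.toLin' (μ i))) →
      ∏ i, (X - C (μ i)) ^ e i ∣ M.charpoly := by
    intro e he
    refine Fintype.prod_dvd_of_coprime
      (fun i j hij => (pairwise_coprime_X_sub_C hμ hij).pow) fun i => ?_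
    refine (pow_dvd_pow _ ((he i).trans (LinearMap.finrank_eigenspace_le _ _))).trans ?_
    rw [Matrix.charpoly_toLin']
    exact pow_rootMultiplicity_dvd _ _
  have hmonic : ∀ e : κ → ℕ, (∏ i, (X - C (μ i)) ^ e i).Monic := fun e =>
    monic_prod_of_monic _ _ fun i _ => (monic_X_sub_C _).pow _
  have hdeg : ∀ e : κ → ℕ, (∏ i, (X - C (μ i)) ^ e i).natDegree = ∑ i, e i := fun e => by
    rw [natDegree_prod_of_monic _ _ fun i _ => (monic_X_sub_C _).pow _]
    simp
  constructor
  · refine (eq_of_monic_of_dvd_of_natDegree_le (hmonic d) M.charpoly_monic (hdvd d hd) ?_)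
    rwa [hdeg, Matrix.charpoly_natDegree_eq_dim]
  · have h := natDegree_le_of_dvd (hdvd _ fun i => le_rfl) M.charpoly_monic.ne_zero
    rw [hdeg, Matrix.charpoly_natDegree_eq_dim] at h
    have h' := (Finset.sum_eq_sum_iff_of_le fun i (_ : i ∈ Finset.univ) => hd i).1
      ((Finset.sum_le_sum fun i _ => hd i).antisymm (h.trans hcard))
    exact fun i => (h' i (Finset.mem_univ i)).symm

open Polynomial in
theorem hasEigenvalue_iff_of_charpoly_eq_prod {ι κ : Type*} [Fintype ι] [DecidableEq ι] [Fintype κ]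
    {M : Matrix ι ι ℝ} {μ : κ → ℝ} {d : κ → ℕ}
    (h : M.charpoly = ∏ i, (X - C (μ i)) ^ d i) (x : ℝ) :
    Module.End.HasEigenvalue M.toLin' x ↔ ∃ i, x = μ i ∧ d i ≠ 0 := by
  rw [Module.End.hasEigenvalue_iff_isRoot_charpoly, Matrix.charpoly_toLin', h, IsRoot, eval_prod,
    Finset.prod_eq_zero_iff]
  simp [sub_eq_zero]

variable {n : ℕ} [LinearOrder (TriangularVertex n)]

/-- A 1-face is determined by its centre and the pair of remaining points. The upper bound is all
the dimension count needs. -/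
theorem card_face_one_le :
    Fintype.card (Face (cliqueComplex (triangularGraph n)) 1) ≤ n * (n - 1).choose 2 := by
  have hex : ∀ F : Face (cliqueComplex (triangularGraph n)) 1, ∃ (a b c : Fin n) (hab : a ≠ b)
      (hac : a ≠ c) (hbc : b ≠ c), F = edgeFace (edge_adj hab hac hbc) := by
    intro F
    obtain ⟨u, v, h, -, rfl⟩ := exists_edgeFace F
    obtain ⟨a, b, c, hab, hac, hbc, rfl, rfl⟩ := exists_edge_of_adj h
    exact ⟨a, b, c, hab, hac, hbc, rfl⟩
  choose a b c hab hac hbc hF using hex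
  have h := Finset.card_le_card_of_injOn
    (s := (Finset.univ : Finset (Face (cliqueComplex (triangularGraph n)) 1)))
    (t := Finset.univ.sigma fun x : Fin n => Finset.powersetCard 2 (Finset.univ.erase x))
    (fun F => ⟨a F, {b F, c F}⟩) ?_ ?_
  · rw [Finset.card_sigma] at h
    simpa using h
  · intro F _
    refine Finset.mem_sigma.2 ⟨Finset.mem_univ _, Finset.mem_powersetCard.2
      ⟨?_, Finset.card_pair (hbc F)⟩⟩
    intro x hx
    simp only [Finset.mem_insert, Finset.mem_singleton] at hx
    rcases hx with rfl | rfl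
    · simp [(hab F).symm]
    · simp [(hac F).symm]
  · intro F _ F' _ h
    simp only [Sigma.mk.injEq, heq_eq_eq] at h
    obtain ⟨h1, h2⟩ := h
    rw [hF F, hF F']
    have key : ∀ {a b c a' b' c' : Fin n} (hab : a ≠ b) (hac : a ≠ c) (hbc : b ≠ c)
        (hab' : a' ≠ b') (hac' : a' ≠ c') (hbc' : b' ≠ c'), a = a' →
        ({b, c} : Finset (Fin n)) = {b', c'} →
        edgeFace (edge_adj hab hac hbc) = edgeFace (edge_adj hab' hac' hbc') := by
      intro a b c a' b' c' hab hac hbc hab' hac' hbc' ha hs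
      have m1 : b ∈ ({b', c'} : Finset (Fin n)) := hs ▸ by simp
      have m2 : c ∈ ({b', c'} : Finset (Fin n)) := hs ▸ by simp
      simp only [Finset.mem_insert, Finset.mem_singleton] at m1 m2
      subst ha
      rcases m1 with rfl | rfl <;> rcases m2 with rfl | rfl
      · exact absurd rfl hbc
      · rfl
      · exact edgeFace_symm _
      · exact absurd rfl hbc
    exact key _ _ (hbc F) _ _ (hbc F') h1 h2

/-- The binomial identities behind the multiplicities. -/
theorem choose_identities (n : ℕ) (hn : 4 ≤ n) :
    3 ∣ n * (n - 2) * (n - 4) ∧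
    n * (n - 2) * (n - 4) / 3 + n.choose 3 = n * (n - 2).choose 2 ∧
    (n.choose 2 - 1) + (n - 1).choose 2 + n * (n - 2) * (n - 4) / 3 + (n - 1).choose 2
      + (n - 1).choose 3 = n * (n - 1).choose 2 := by
  obtain ⟨k, rfl⟩ := Nat.exists_eq_add_of_le' hn
  have e1 : k + 4 - 1 = k + 3 := rfl
  have e2 : k + 4 - 2 = k + 2 := rfl
  have e4 : k + 4 - 4 = k := rfl
  rw [e1, e2, e4]
  have h1 := Nat.add_one_mul_choose_eq (k + 1) 1
  have h2 := Nat.add_one_mul_choose_eq (k + 2) 1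
  have h3' := Nat.add_one_mul_choose_eq (k + 3) 1
  have h4 := Nat.add_one_mul_choose_eq (k + 3) 2
  have h5 := Nat.add_one_mul_choose_eq (k + 2) 2
  simp only [Nat.choose_one_right] at h1 h2 h3' h4 h5
  norm_num only [add_assoc] at h1 h2 h3' h4 h5
  obtain ⟨z, hz⟩ : ∃ z, (k + 4).choose 2 = z + 1 :=
    Nat.exists_eq_add_of_le' (Nat.choose_pos (by omega))
  -- The second identity multiplied by 3; divisibility by 3 is read off from it.
  have hD : (k + 4) * (k + 2) * k + 3 * (k + 4).choose 3 = 3 * ((k + 4) * (k + 2).choose 2) := by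
    qify at *
    linear_combination -h4 - (k + 4) / 2 * h2 + 3 / 2 * (k + 4) * h1
  have h3 : 3 ∣ (k + 4) * (k + 2) * k := (Nat.dvd_add_left (dvd_mul_right 3 _)).1 ⟨_, hD⟩
  refine ⟨h3, ?_⟩
  obtain ⟨D, hDD⟩ := h3
  rw [hDD, Nat.mul_div_cancel_left D (by norm_num), hz, Nat.add_sub_cancel]
  rw [hDD, ← mul_add] at hD
  refine ⟨Nat.eq_of_mul_eq_mul_left (by norm_num) hD, ?_⟩
  rw [hz] at h3'
  qify at *
  linear_combination -1 / 2 * h3' - 1 / 3 * hDD - 1 / 3 * h5 - (k + 3) / 6 * h1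
    + (k + 2) / 2 * h2

end Spectrum

end CliqueSpectra

/-! ### The spectrum of the up-Laplacian. -/

theorem mainTheorem1 (n : ℕ) (hn : 4 ≤ n)
    [LinearOrder (CliqueSpectra.TriangularVertex n)] :
    let L := CliqueSpectra.upLaplacian
      (CliqueSpectra.cliqueComplex (CliqueSpectra.triangularGraph n)) 1
    -- the list of all eigenvalues with their algebraic multiplicities
    L.charpoly =
        Polynomial.X ^ (n.choose 2 - 1)
        * (Polynomial.X - Polynomial.C 2) ^ ((n - 1).choose 2)
        * (Polynomial.X - Polynomial.C ((n : ℝ) - 1)) ^ (n * (n - 2) * (n - 4) / 3)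
        * (Polynomial.X - Polynomial.C (n : ℝ)) ^ ((n - 1).choose 2)
        * (Polynomial.X - Polynomial.C ((n : ℝ) + 2)) ^ ((n - 1).choose 3)
    -- the third exponent is an exact quotient
    ∧ 3 ∣ n * (n - 2) * (n - 4)
    -- the dimensions of the eigenspaces
    ∧ Module.finrank ℝ (Module.End.eigenspace L.toLin' 0) = n.choose 2 - 1
    ∧ Module.finrank ℝ (Module.End.eigenspace L.toLin' 2) = (n - 1).choose 2
    ∧ Module.finrank ℝ (Module.End.eigenspace L.toLin' ((n : ℝ) - 1))
        = n * (n - 2) * (n - 4) / 3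
    ∧ Module.finrank ℝ (Module.End.eigenspace L.toLin' (n : ℝ)) = (n - 1).choose 2
    ∧ Module.finrank ℝ (Module.End.eigenspace L.toLin' ((n : ℝ) + 2)) = (n - 1).choose 3
    -- the set of eigenvalues
    ∧ (5 ≤ n → ∀ μ : ℝ, Module.End.HasEigenvalue L.toLin' μ ↔
        μ ∈ ({0, 2, (n : ℝ) - 1, (n : ℝ), (n : ℝ) + 2} : Set ℝ))
    ∧ (n = 4 → ∀ μ : ℝ, Module.End.HasEigenvalue L.toLin' μ ↔
        μ ∈ ({0, 2, 4, 6} : Set ℝ)) := by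
  intro L
  obtain ⟨h3, hsub, hsum⟩ := CliqueSpectra.choose_identities n hn
  have hn' : (4 : ℝ) ≤ n := by exact_mod_cast hn
  have hn1 : n = n - 1 + 1 := by omega
  let ev : Fin 5 → ℝ := ![0, 2, (n : ℝ) - 1, (n : ℝ), (n : ℝ) + 2]
  let d : Fin 5 → ℕ := ![n.choose 2 - 1, (n - 1).choose 2, n * (n - 2) * (n - 4) / 3,
    (n - 1).choose 2, (n - 1).choose 3]
  -- The inequality 2 < n - 1 uses n ≥ 4.
  have hev : StrictMono ev := by
    refine Fin.strictMono_iff_lt_succ.2 fun i => ?_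
    fin_cases i <;> (simp [ev]; try linarith)
  have hd : ∀ i, d i ≤ Module.finrank ℝ (Module.End.eigenspace L.toLin' (ev i)) := by
    intro i
    fin_cases i
    · exact CliqueSpectra.choose_two_sub_one_le_finrank_eigenspace_zero (by omega)
    · exact CliqueSpectra.choose_two_le_finrank_eigenspace_two hn1 hn
    · have := CliqueSpectra.le_finrank_eigenspace_sub_one (n := n) (m := n - 2) (by omega)
      rw [← hsub] at this
      exact Nat.le_of_add_le_add_right this
    · exact CliqueSpectra.choose_two_le_finrank_eigenspace hn1 (by omega)
    · exact CliqueSpectra.choose_three_le_finrank_eigenspace hn1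
  obtain ⟨hchar, hdim⟩ := CliqueSpectra.charpoly_eq_prod_of_le_finrank L hev.injective hd (by
    refine CliqueSpectra.card_face_one_le.trans (hsum.symm.trans ?_).le
    simp [d, Fin.sum_univ_five])
  have heig := CliqueSpectra.hasEigenvalue_iff_of_charpoly_eq_prod hchar
  have p0 : n.choose 2 - 1 ≠ 0 := by
    have := Nat.choose_le_choose 2 hn
    have e : Nat.choose 4 2 = 6 := rfl
    omega
  have p1 : (n - 1).choose 2 ≠ 0 := (Nat.choose_pos (by omega)).ne'
  have p4 : (n - 1).choose 3 ≠ 0 := (Nat.choose_pos (by omega)).ne'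
  refine ⟨?_, h3, hdim 0, hdim 1, hdim 2, hdim 3, hdim 4, fun h5 μ => ?_, fun h4 μ => ?_⟩
  · rw [hchar, Fin.prod_univ_five]
    simp [ev, d]
  · have p2 : n * (n - 2) * (n - 4) / 3 ≠ 0 := by
      have : 0 < n * (n - 2) * (n - 4) :=
        Nat.mul_pos (Nat.mul_pos (by omega) (by omega)) (by omega)
      exact (Nat.div_pos (Nat.le_of_dvd this h3) (by norm_num)).ne'
    rw [heig]
    simp [Fin.exists_fin_succ, ev, d, p0, p1, p2, p4]
  · rw [heig]
    subst h4
    have e : Nat.choose 4 2 = 6 := rfl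
    simp [Fin.exists_fin_succ, ev, d, e]
    norm_num
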